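/- Definitions. For a nonempty finite index set $I$ and $\mathbf a=(a_i)_{i\in I}$ with $a_i>0$, the generalized Bernoulli–Exponential distribution with parameters $\mathbf a$ is the law of the random vector $((1-B_i)E_i)_{i\in I}$, where $B$ takes the value of the $i$-th canonical vector $\mathrm e_i$ with probability $a_i/\sum_{j\in I} a_j$, and $E=(E_i)_{i\in I}$ is independent of $B$ and has independent entries, $E_i$ being exponential with rate $a_i$. Let $G=(V,\mathcal E)$ be a finite directed graph, $\mathcal E\subseteq V\times V$ (loops are allowed). For $x\in V$ let $\mathcal E_x$ be the set of edges leaving $x$ and $\mathcal E^x$ the set of edges arriving at $x$. A path is a finite sequence $(x_0,\dots,x_n)$ of vertices with $\Delta x_i:=(x_i,x_{i+1})\in\mathcal E$ for $0\le i\le n-1$; it is closed if $x_n=x_0$. $G$ is strongly connected if for all $x,y\in V$ there is a path from $x$ to $y$. Given positive weights $\mathbf a=(a_e)_{e\in\mathcal E}$, a generalized Bernoulli–Exponential environment on $G$ with parameters $\mathbf a$ is a family $\omega=(\omega(x))_{x\in V}$ of independent random vectors such that, for each $x\in V$, $\omega(x)=(\omega(x,e))_{e\in\mathcal E_x}$ has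 the generalized Bernoulli–Exponential distribution with parameters $(a_e)_{e\in\mathcal E_x}$. The divergence of $\mathbf a$ is $\mathrm{div}(\mathbf a)(x)=\sum_{e\in\mathcal E^x}a_e-\sum_{e\in\mathcal E_x}a_e$, $x\in V$. The dual graph $\check G=(V,\check{\mathcal E})$ has the reversed edges $\check e=(y,x)$, $e=(x,y)\in\mathcal E$, with reversed weights $\check a_{\check e}=a_e$. A function $f:\mathcal E\to\mathbb R$ satisfies the closed loop property if $\sum_{i=0}^{n-1}f(\Delta x_i)=0$ for every closed path $(x_0,\dots,x_n)$. Theorem 1. Let $G=(V,\mathcal E)$ be a finite strongly connected directed graph in which every vertex has at least one outgoing edge (this excludes only the graph with one vertex and no edge), endowed with positive weights $\mathbf a=(a_e)_{e\in\mathcal E}$ such that $\mathrm{div}(\mathbf a)=0$. Then there exists a coupling $(\omega,\check\omega,\varphi)$, that is, a probability space on which $\omega,\check\omega,\varphi$ are all defined, such that: i. $\omega$ is a generalized Bernoulli–Exponential environment on $G$ with parameters $\mathbf a$; ii. $\check\omega$ is a generalized Bernoulli–Exponential environment on $\check G$ with parameters $\check{\mathbf a}$; iii. $\varphi=(\varphi(e))_{e\in\mathcal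 E}$ is a random function that satisfies the closed loop property almost surely; iv. almost surely, $\check\omega(y,\check e)=\varphi(e)+\omega(x,e)$ for all $e=(x,y)\in\mathcal E$. In particular, almost surely, for every closed path $(x_0,\dots,x_n)$ of $G$, with time reversal $(\check x_0,\dots,\check x_n):=(x_n,\dots,x_0)$ and $\Delta\check x_i:=(\check x_i,\check x_{i+1})$, $$\sum_{i=0}^{n-1}\omega(x_i,\Delta x_i)=\sum_{i=0}^{n-1}\check\omega(\check x_i,\Delta\check x_i).$$ -/

import Mathlib

open MeasureTheory ProbabilityTheory

/-! ### The generalized Bernoulli–Exponential distribution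

Vectors of order `M` are indexed by an arbitrary finite type `ι` with `M` elements. -/

open Classical in
/-- The generalized Bernoulli distribution with parameters `p`: the canonical vector `eᵢ` has
probability `p i`. -/
noncomputable def genBernoulli {ι : Type*} [Fintype ι] (p : ι → ℝ) : Measure (ι → ℝ) :=
  ∑ i, ENNReal.ofReal (p i) • Measure.dirac (Pi.single i (1 : ℝ))

/-- The law of a random vector with independent entries, the `i`-th being exponential with
parameter (rate) `a i`. -/
noncomputable def expVector {ι : Type*} [Fintype ι] (a : ι → ℝ) : Measure (ι → ℝ) :=
  Measure.pi fun i => expMeasure (a i)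

/-- The generalized Bernoulli–Exponential distribution with parameters `a`: the law of
`((1 - Bᵢ) Eᵢ)ᵢ`, where `B` is generalized Bernoulli with parameters `aᵢ / ∑ⱼ aⱼ`, and `E` is
independent of `B` and has independent exponential entries with parameters `aᵢ`. -/
noncomputable def bernoulliExp {ι : Type*} [Fintype ι] (a : ι → ℝ) : Measure (ι → ℝ) :=
  ((genBernoulli fun i => a i / ∑ j, a j).prod (expVector a)).map
    fun q i => (1 - q.1 i) * q.2 i

namespace Digraph

variable {V : Type*}

/-- The edges of a directed graph, as ordered pairs of vertices (loops are allowed). -/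
@[ext]
structure Edge (G : Digraph V) where
  /-- the vertex that the edge leaves -/
  src : V
  /-- the vertex at which the edge arrives -/
  tgt : V
  adj : G.Adj src tgt

noncomputable instance instFintypeEdge [Fintype V] (G : Digraph V) : Fintype G.Edge :=
  Fintype.ofInjective (fun e : G.Edge => (e.src, e.tgt)) fun e f h => by
    simp only [Prod.mk.injEq] at h
    exact Edge.ext h.1 h.2

/-- The set of edges leaving `x`, as a type. -/
def OutEdge (G : Digraph V) (x : V) : Type _ := {e : G.Edge // e.src = x}

noncomputable instance instFintypeOutEdge [Fintype V] (G : Digraph V) (x : V) :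
    Fintype (G.OutEdge x) :=
  Fintype.ofInjective (fun e : G.OutEdge x => (e.1 : G.Edge)) Subtype.val_injective

/-- The dual graph: all edges are reversed. -/
def dual (G : Digraph V) : Digraph V where
  Adj x y := G.Adj y x

/-- The reversal `ě = (y, x)` of the edge `e = (x, y)`. -/
def Edge.rev {G : Digraph V} (e : G.Edge) : G.dual.Edge := ⟨e.tgt, e.src, e.adj⟩

/-- The edge of `G` whose reversal is a given edge of the dual graph. -/
def Edge.unrev {G : Digraph V} (e : G.dual.Edge) : G.Edge := ⟨e.tgt, e.src, e.adj⟩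

/-- The reversed weights on the dual graph, `ǎ(ě) = a(e)`. -/
def dualWeight {G : Digraph V} (a : G.Edge → ℝ) : G.dual.Edge → ℝ := fun e => a e.unrev

open Classical in
/-- The divergence of `θ` at `x`: the sum over the edges arriving at `x` minus the sum over the
edges leaving `x`. -/
noncomputable def div [Fintype V] {G : Digraph V} (θ : G.Edge → ℝ) (x : V) : ℝ :=
  (∑ e : G.Edge with e.tgt = x, θ e) - ∑ e : G.Edge with e.src = x, θ e

/-- A path `(x₀, …, xₙ)`, with an edge from each vertex to the next. -/
structure Path (G : Digraph V) where
  /-- the number `n` of steps -/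
  length : ℕ
  /-- the vertices `x₀, …, xₙ` -/
  vert : Fin (length + 1) → V
  adj : ∀ i : Fin length, G.Adj (vert i.castSucc) (vert i.succ)

namespace Path

variable {G : Digraph V}

/-- The `i`-th edge `Δxᵢ = (xᵢ, xᵢ₊₁)` of a path. -/
def step (π : G.Path) (i : Fin π.length) : G.Edge :=
  ⟨π.vert i.castSucc, π.vert i.succ, π.adj i⟩

/-- A path is closed if it ends where it starts. -/
def IsClosed (π : G.Path) : Prop := π.vert (Fin.last π.length) = π.vert 0

/-- The time reversal `(xₙ, …, x₀)` of a path, a path in the dual graph. -/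
def reverse (π : G.Path) : G.dual.Path where
  length := π.length
  vert i := π.vert i.rev
  adj i := by
    have h := π.adj i.rev
    rw [← Fin.rev_castSucc, ← Fin.rev_succ] at h
    exact h

/-- The sum of a function on the edges along a path; for an environment, the passage time of the
path. -/
def sum (π : G.Path) (f : G.Edge → ℝ) : ℝ := ∑ i : Fin π.length, f (π.step i)

end Path

/-- Any vertex can be reached from any vertex by a path. -/
def StronglyConnected (G : Digraph V) : Prop :=
  ∀ x y : V, ∃ π : G.Path, π.vert 0 = x ∧ π.vert (Fin.last π.length) = y

/-- The closed loop property: `f` sums to zero along every closed path. -/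
def ClosedLoop (G : Digraph V) (f : G.Edge → ℝ) : Prop :=
  ∀ π : G.Path, π.IsClosed → π.sum f = 0

/-- `ω` is a generalized Bernoulli–Exponential environment on `G` with parameters `a`: the vectors
`ω(x) = (ω(x, e))`, `e` ranging over the edges leaving `x`, are independent over the vertices `x`,
and `ω(x)` has the generalized Bernoulli–Exponential distribution whose parameters are the weights
of these edges. As `e` determines the vertex `x` that it leaves, `ω(x, e)` is written `ω e`. -/
structure IsBernoulliExpEnvironment [Fintype V] (G : Digraph V) (a : G.Edge → ℝ)
    {Ω : Type*} [MeasurableSpace Ω] (μ : Measure Ω) (ω : G.Edge → Ω → ℝ) : Prop where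
  measurable : ∀ e, Measurable (ω e)
  hasLaw : ∀ x : V, HasLaw (fun w (e : G.OutEdge x) => ω e.1 w)
    (bernoulliExp fun e : G.OutEdge x => a e.1) μ
  indep : iIndepFun (fun (x : V) w (e : G.OutEdge x) => ω e.1 w) μ

end Digraph

/-!
The closed loop property is dual to the circulations: a closed path crosses each edge a number of
times, and this defines a function on the edges that has no divergence (`Path.IsClosed.div_flow`).
Thus it suffices to couple `ω` and `ω'` such that `φ = ω' - ω`, with the edges of the dual graph
reversed, is almost surely orthogonal to all circulations. Such a coupling exists as soon as the
orthogonal projections of `ω` and `ω'` on the space of circulations have the same law: draw `ω`,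
and then `ω'` from its conditional law given its projection (`exists_coupling_of_map_eq`).

The projections have the same law because the characteristic functions of `ω` and `ω'` agree at
each circulation `t`. Indeed, the characteristic function at `t` of the Bernoulli–Exponential
distribution with parameters `a` has the closed form
`((∑ᵢ aᵢ - I ∑ᵢ tᵢ) / ∑ᵢ aᵢ) * ∏ᵢ (aᵢ / (aᵢ - I tᵢ))` (`integral_cexp_bernoulliExp`).
In the product over the vertices, the last factors give a product over all edges, which does not change when the edges
are reversed; the others depend only on the sums of `a` and of `t` over the edges leaving a vertex,
and these are also the sums over the edges arriving there, as `a` and `t` have no divergence.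
-/

/-! ### Characteristic functions of exponential and Bernoulli–Exponential laws -/

open Complex in
theorem integral_cexp_expMeasure {a : ℝ} (ha : 0 < a) (t : ℝ) :
    ∫ x, cexp ((t * x : ℝ) * I) ∂(expMeasure a) = a / (a - t * I) := by
  have hne : (-a + t * I : ℂ) ≠ 0 := fun h => by
    have := congrArg re h
    simp at this
    exact ha.ne' this
  have hne' : (a - t * I : ℂ) ≠ 0 := fun h => hne (by linear_combination -h)
  rw [show expMeasure a = volume.withDensity (exponentialPDF a) from rfl,
    integral_withDensity_eq_integral_toReal_smul₀
      (f := exponentialPDF a) (measurable_exponentialPDFReal a).ennreal_ofReal.aemeasurable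
      (.of_forall fun x => ENNReal.ofReal_lt_top)]
  have h1 : ∀ x : ℝ, (exponentialPDF a x).toReal • cexp ((t * x : ℝ) * I)
      = (Set.Ici (0 : ℝ)).indicator (fun x : ℝ => a * cexp ((-a + t * I) * x)) x := by
    intro x
    by_cases hx : 0 ≤ x
    · rw [exponentialPDF_of_nonneg hx, ENNReal.toReal_ofReal (by positivity),
        Set.indicator_of_mem (by exact hx), real_smul, ofReal_mul, ofReal_exp, mul_assoc,
        ← exp_add]
      congr 2
      push_cast
      ring
    · rw [exponentialPDF_of_neg (not_le.mp hx), Set.indicator_of_notMem (by simpa using hx)]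
      simp
  simp_rw [h1]
  rw [integral_indicator measurableSet_Ici, integral_Ici_eq_integral_Ioi, integral_const_mul,
    integral_exp_mul_complex_Ioi (by simpa using ha)]
  simp only [ofReal_zero, mul_zero, exp_zero]
  field_simp
  ring

section BernoulliExp

variable {ι : Type*} [Fintype ι]

theorem integral_genBernoulli {p : ι → ℝ} (hp : ∀ i, 0 ≤ p i) [DecidableEq ι]
    {f : (ι → ℝ) → ℂ} (hf : Measurable f) :
    ∫ b, f b ∂(genBernoulli p) = ∑ i, (p i : ℂ) * f (Pi.single i 1) := by
  rw [genBernoulli, integral_finsetSum_measure]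
  · refine Finset.sum_congr rfl fun i _ => ?_
    rw [integral_smul_measure, integral_dirac' _ _ hf.stronglyMeasurable,
      ENNReal.toReal_ofReal (hp i), Complex.real_smul]
    congr!
  · intro i _
    refine Integrable.smul_measure ?_ ENNReal.ofReal_ne_top
    exact integrable_dirac' hf.stronglyMeasurable (by simp)

theorem isProbabilityMeasure_genBernoulli {p : ι → ℝ} (hp : ∀ i, 0 ≤ p i) (hsum : ∑ i, p i = 1) :
    IsProbabilityMeasure (genBernoulli p) := by
  constructor
  simp only [genBernoulli, Measure.coe_finsetSum, Finset.sum_apply, Measure.smul_apply,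
    measure_univ, smul_eq_mul, mul_one]
  rw [← ENNReal.ofReal_sum_of_nonneg fun i _ => hp i, hsum, ENNReal.ofReal_one]

variable {a : ι → ℝ}

theorem isProbabilityMeasure_expVector (ha : ∀ i, 0 < a i) :
    IsProbabilityMeasure (expVector a) := by
  have := fun i => isProbabilityMeasure_expMeasure (ha i)
  unfold expVector
  infer_instance

variable [Nonempty ι]

theorem isProbabilityMeasure_genBernoulli_div_sum (ha : ∀ i, 0 < a i) :
    IsProbabilityMeasure (genBernoulli fun i => a i / ∑ j, a j) := by
  have hA : 0 < ∑ j, a j := Finset.sum_pos (fun i _ => ha i) Finset.univ_nonempty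
  refine isProbabilityMeasure_genBernoulli (fun i => (div_pos (ha i) hA).le) ?_
  rw [← Finset.sum_div, div_self hA.ne']

theorem isProbabilityMeasure_bernoulliExp (ha : ∀ i, 0 < a i) :
    IsProbabilityMeasure (bernoulliExp a) := by
  have := isProbabilityMeasure_genBernoulli_div_sum ha
  have := isProbabilityMeasure_expVector ha
  exact Measure.isProbabilityMeasure_map (by fun_prop)

open Complex in
/-- The characteristic function of the generalized Bernoulli–Exponential law is that of the vector
of independent exponentials times a factor that depends only on the sums of `a` and `t`. This is
what makes the time reversal work: conditioning on the coordinate `i` that vanishes removes the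
`i`-th factor `aᵢ / (aᵢ - I tᵢ)`, and averaging with weights `aᵢ` gives `∑ᵢ (aᵢ - I tᵢ)`. -/
theorem integral_cexp_bernoulliExp (ha : ∀ i, 0 < a i) (t : ι → ℝ) :
    ∫ x, cexp ((∑ i, t i * x i : ℝ) * I) ∂(bernoulliExp a) =
      ((∑ i, a i : ℝ) - (∑ i, t i : ℝ) * I) / (∑ i, a i : ℝ) * ∏ i, (a i / (a i - t i * I)) := by
  classical
  have := isProbabilityMeasure_genBernoulli_div_sum ha
  have := isProbabilityMeasure_expVector ha
  have := fun i => isProbabilityMeasure_expMeasure (ha i)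
  have hA : 0 < ∑ j, a j := Finset.sum_pos (fun i _ => ha i) Finset.univ_nonempty
  have hA' : ((∑ j, a j : ℝ) : ℂ) ≠ 0 := by exact_mod_cast hA.ne'
  have hne : ∀ i, (a i - t i * I : ℂ) ≠ 0 := fun i h => (ha i).ne' (by simpa using congrArg re h)
  have hne' : ∀ i, (a i : ℂ) ≠ 0 := fun i => by exact_mod_cast (ha i).ne'
  have hmeas : Measurable fun q : (ι → ℝ) × (ι → ℝ) =>
      cexp ((∑ i, t i * ((1 - q.1 i) * q.2 i) : ℝ) * I) := by fun_prop
  have hmeas' : Measurable fun x : ι → ℝ => cexp ((∑ i, t i * x i : ℝ) * I) := by fun_prop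
  rw [bernoulliExp, integral_map (by fun_prop) hmeas'.aestronglyMeasurable,
    integral_prod _ (Integrable.of_bound hmeas.aestronglyMeasurable 1
      (.of_forall fun q => (norm_exp_ofReal_mul_I _).le)),
    integral_genBernoulli (fun i => (div_pos (ha i) hA).le)
      hmeas.stronglyMeasurable.integral_prod_right.measurable]
  have key : ∀ i, ∫ q, cexp ((∑ j, t j * ((1 - (Pi.single i 1 : ι → ℝ) j) * q j) : ℝ) * I)
      ∂(expVector a) = (a i - t i * I) / a i * ∏ j, (a j / (a j - t j * I)) := by
    intro i
    have h1 : ∀ q : ι → ℝ,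
        cexp ((∑ j, t j * ((1 - (Pi.single i 1 : ι → ℝ) j) * q j) : ℝ) * I)
          = ∏ j, cexp ((t j * (1 - (Pi.single i 1 : ι → ℝ) j) * q j : ℝ) * I) := by
      intro q
      rw [← exp_sum, ← Finset.sum_mul, ← ofReal_sum]
      simp_rw [mul_assoc]
    simp_rw [h1]
    rw [expVector, integral_fintype_prod_eq_prod
      (f := fun j x => cexp ((t j * (1 - (Pi.single i 1 : ι → ℝ) j) * x : ℝ) * I))]
    simp_rw [fun j => integral_cexp_expMeasure (ha j)]
    rw [← Finset.mul_prod_erase _ _ (Finset.mem_univ i),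
      ← Finset.mul_prod_erase _ (fun j => (a j / (a j - t j * I) : ℂ)) (Finset.mem_univ i),
      ← mul_assoc]
    congr 1
    · have := hne i
      have := hne' i
      simp only [Pi.single_eq_same, sub_self, mul_zero, ofReal_zero, zero_mul, sub_zero]
      field_simp
    · refine Finset.prod_congr rfl fun j hj => ?_
      rw [Pi.single_eq_of_ne (Finset.ne_of_mem_erase hj), sub_zero, mul_one]
  simp_rw [key]
  rw [← Finset.sum_congr rfl fun i _ => mul_assoc _ _ _, ← Finset.sum_mul]
  congr 1
  have h2 : ∀ i, ((a i / ∑ j, a j : ℝ) : ℂ) * ((a i - t i * I) / a i)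
      = (a i - t i * I) / (∑ j, a j : ℝ) := by
    intro i
    have := hne' i
    rw [ofReal_div]
    field_simp
  simp_rw [h2]
  rw [← Finset.sum_div, Finset.sum_sub_distrib, ← Finset.sum_mul, ofReal_sum, ofReal_sum]

end BernoulliExp

/-! ### Couplings with a prescribed projection -/

/-- If `f` and `g` push two laws to the same law, the laws can be coupled such that `f = g` almost
surely: given `x`, draw `y` from the conditional distribution of `y` given `g y = f x`. -/
theorem exists_coupling_of_map_eq {X Y Z : Type*} [MeasurableSpace X] [MeasurableSpace Y]
    [StandardBorelSpace Y] [Nonempty Y] [MeasurableSpace Z] [MeasurableEq Z]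
    (μ : Measure X) (ν : Measure Y) [IsProbabilityMeasure μ] [IsProbabilityMeasure ν]
    {f : X → Z} {g : Y → Z} (hf : Measurable f) (hg : Measurable g) (h : μ.map f = ν.map g) :
    ∃ ρ : Measure (X × Y), IsProbabilityMeasure ρ ∧ ρ.map Prod.fst = μ ∧ ρ.map Prod.snd = ν ∧
      ∀ᵐ p ∂ρ, f p.1 = g p.2 := by
  have hfp : Measurable fun p : X × Y => (f p.1, p.2) := by fun_prop
  have key : (μ ⊗ₘ (condDistrib id g ν).comap f hf).map (fun p => (f p.1, p.2))
      = ν.map fun y => (g y, y) := by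
    refine Eq.trans ?_ (compProd_map_condDistrib (X := g) (Y := id) aemeasurable_id)
    rw [← h]
    ext s hs
    rw [Measure.map_apply hfp hs, Measure.compProd_apply (hfp hs), Measure.compProd_apply hs,
      lintegral_map (Kernel.measurable_kernel_prodMk_left hs) hf]
    rfl
  refine ⟨μ ⊗ₘ (condDistrib id g ν).comap f hf, inferInstance, Measure.fst_compProd _ _, ?_, ?_⟩
  · have := congrArg (Measure.map Prod.snd) key
    rw [Measure.map_map measurable_snd hfp, Measure.map_map measurable_snd (by fun_prop)] at this
    exact this.trans Measure.map_id
  · refine ae_of_ae_map hfp.aemeasurable (p := fun q : Z × Y => q.1 = g q.2) ?_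
    rw [key, ae_map_iff (by fun_prop) (measurableSet_eq_fun measurable_fst (by fun_prop))]
    simp

/-- If two laws on a Euclidean space have characteristic functions that agree on a subspace `K`,
then they can be coupled such that the difference is almost surely orthogonal to `K`. -/
theorem exists_coupling_sub_mem_orthogonal {E : Type*} [NormedAddCommGroup E]
    [InnerProductSpace ℝ E] [FiniteDimensional ℝ E] [MeasurableSpace E] [BorelSpace E]
    (μ ν : Measure E) [IsProbabilityMeasure μ] [IsProbabilityMeasure ν] (K : Submodule ℝ E)
    (h : ∀ t ∈ K, charFun μ t = charFun ν t) :
    ∃ ρ : Measure (E × E), IsProbabilityMeasure ρ ∧ ρ.map Prod.fst = μ ∧ ρ.map Prod.snd = ν ∧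
      ∀ᵐ p ∂ρ, p.2 - p.1 ∈ Kᗮ := by
  have : CompleteSpace E := FiniteDimensional.complete ℝ E
  have hP : Measurable K.starProjection := K.starProjection.continuous.measurable
  have hmap : μ.map K.starProjection = ν.map K.starProjection := by
    have := Measure.isProbabilityMeasure_map (μ := μ) hP.aemeasurable
    have := Measure.isProbabilityMeasure_map (μ := ν) hP.aemeasurable
    refine Measure.ext_of_charFun (funext fun t => ?_)
    have key : ∀ m : Measure E, charFun (m.map K.starProjection) t
        = charFun m (K.starProjection t) := by
      intro m
      rw [charFun_apply, charFun_apply, integral_map hP.aemeasurable (by fun_prop)]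
      simp_rw [Submodule.inner_starProjection_left_eq_right]
    rw [key, key, h _ (K.starProjection_apply_mem t)]
  obtain ⟨ρ, hρ, h1, h2, h3⟩ := exists_coupling_of_map_eq μ ν hP hP hmap
  refine ⟨ρ, hρ, h1, h2, h3.mono fun p hp => ?_⟩
  rw [← Submodule.starProjection_apply_eq_zero_iff, map_sub, hp, sub_self]

/-! ### Sums over edges and paths -/

namespace Digraph

variable {V : Type*} {G : Digraph V}

theorem Path.step_reverse (π : G.Path) (i : Fin π.length) :
    π.reverse.step i = (π.step i.rev).rev :=
  Edge.ext (congrArg π.vert (Fin.rev_castSucc i)) (congrArg π.vert (Fin.rev_succ i))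

theorem Path.sum_reverse (π : G.Path) (f : G.dual.Edge → ℝ) :
    π.reverse.sum f = π.sum fun e => f e.rev := by
  refine (Finset.sum_congr rfl fun i _ => congrArg f (π.step_reverse i)).trans ?_
  exact Equiv.sum_comp Fin.revPerm fun i => f (π.step i).rev

/-- Reversal, as a bijection between the edges of a graph and those of its dual. -/
def Edge.revEquiv (G : Digraph V) : G.Edge ≃ G.dual.Edge where
  toFun := rev
  invFun := unrev
  left_inv _ := rfl
  right_inv _ := rfl

open Classical in
/-- The number of times that a path goes through each edge. -/
noncomputable def Path.flow (π : G.Path) (e : G.Edge) : ℝ :=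
  ∑ i, if π.step i = e then 1 else 0

variable [Fintype V]

theorem Path.sum_flow_mul (π : G.Path) (f : G.Edge → ℝ) : ∑ e, π.flow e * f e = π.sum f := by
  classical
  simp only [flow, Finset.sum_mul, ite_mul, one_mul, zero_mul]
  rw [Finset.sum_comm]
  refine Finset.sum_congr rfl fun i _ => ?_
  rw [Finset.sum_ite_eq, if_pos (Finset.mem_univ _)]

theorem Path.IsClosed.div_flow {π : G.Path} (hπ : π.IsClosed) (x : V) : div π.flow x = 0 := by
  classical
  let g : Fin (π.length + 1) → ℝ := fun i => if π.vert i = x then 1 else 0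
  have h : div π.flow x = ∑ i : Fin π.length, g i.succ - ∑ i : Fin π.length, g i.castSucc := by
    simp only [div, Finset.sum_filter, ← mul_boole _ (π.flow _), sum_flow_mul]
    rfl
  have h1 := Fin.sum_univ_succ g
  have h2 := Fin.sum_univ_castSucc g
  have h3 : g (Fin.last _) = g 0 := by simp only [g]; rw [hπ]
  rw [h]
  linarith

open Classical in
@[to_additive]
theorem prod_outEdge {M : Type*} [CommMonoid M] (x : V) (f : G.Edge → M) :
    ∏ e : G.OutEdge x, f e.1 = ∏ e : G.Edge with e.src = x, f e :=
  Finset.prod_bij (fun e _ => e.1) (fun e _ => by simpa using e.2)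
    (fun _ _ _ _ h => Subtype.ext h) (fun e he => ⟨⟨e, by simpa using he⟩, Finset.mem_univ _, rfl⟩)
    (fun _ _ => rfl)

@[to_additive]
theorem prod_prod_outEdge {M : Type*} [CommMonoid M] (f : G.Edge → M) :
    ∏ x, ∏ e : G.OutEdge x, f e.1 = ∏ e, f e := by
  classical
  simp_rw [fun x => prod_outEdge (G := G) x f]
  exact Finset.prod_fiberwise _ _ _

open Classical in
theorem sum_outEdge_dual (x : V) (f : G.Edge → ℝ) :
    ∑ e : G.dual.OutEdge x, f e.1.unrev = ∑ e : G.Edge with e.tgt = x, f e := by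
  rw [sum_outEdge x fun e : G.dual.Edge => f e.unrev, Finset.sum_filter, Finset.sum_filter]
  exact (Equiv.sum_comp (Edge.revEquiv G) fun e => if e.src = x then f e.unrev else 0).symm

theorem sum_outEdge_dual_of_div_eq_zero {f : G.Edge → ℝ} {x : V} (h : div f x = 0) :
    ∑ e : G.dual.OutEdge x, f e.1.unrev = ∑ e : G.OutEdge x, f e.1 := by
  rw [sum_outEdge_dual, sum_outEdge]
  exact sub_eq_zero.mp h

theorem nonempty_outEdge_dual {a : G.Edge → ℝ} (ha : ∀ e, 0 < a e) {x : V} (h : div a x = 0)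
    [Nonempty (G.OutEdge x)] : Nonempty (G.dual.OutEdge x) := by
  by_contra hempty
  rw [not_nonempty_iff] at hempty
  have hpos : 0 < ∑ e : G.OutEdge x, a e.1 :=
    Finset.sum_pos (fun e _ => ha e.1) Finset.univ_nonempty
  rw [← sum_outEdge_dual_of_div_eq_zero h, Finset.univ_eq_empty, Finset.sum_empty] at hpos
  exact hpos.false

/-! ### The law of a Bernoulli–Exponential environment -/

/-- The law on `ℝ^E` of a generalized Bernoulli–Exponential environment. -/
noncomputable def envLaw (G : Digraph V) (a : G.Edge → ℝ) : Measure (G.Edge → ℝ) :=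
  (Measure.pi fun x => bernoulliExp fun e : G.OutEdge x => a e.1).map
    fun u e => u e.src ⟨e, rfl⟩

variable {a : G.Edge → ℝ}

theorem isProbabilityMeasure_envLaw (ha : ∀ e, 0 < a e) [∀ x, Nonempty (G.OutEdge x)] :
    IsProbabilityMeasure (G.envLaw a) := by
  have := fun x => isProbabilityMeasure_bernoulliExp fun e : G.OutEdge x => ha e.1
  exact Measure.isProbabilityMeasure_map (Measurable.aemeasurable (by fun_prop))

theorem isBernoulliExpEnvironment_of_map_eq (ha : ∀ e, 0 < a e) [∀ x, Nonempty (G.OutEdge x)]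
    {Ω : Type*} [MeasurableSpace Ω] {μ : Measure Ω} [IsProbabilityMeasure μ] {ω : G.Edge → Ω → ℝ}
    (hω : ∀ e, Measurable (ω e)) (h : μ.map (fun w e => ω e w) = G.envLaw a) :
    G.IsBernoulliExpEnvironment a μ ω := by
  have := fun x => isProbabilityMeasure_bernoulliExp fun e : G.OutEdge x => ha e.1
  have hcurry : Measurable fun (u : G.Edge → ℝ) (x : V) (e : G.OutEdge x) => u e.1 := by fun_prop
  have hmeas : Measurable fun w (x : V) (e : G.OutEdge x) => ω e.1 w := by fun_prop
  have hpi : μ.map (fun w (x : V) (e : G.OutEdge x) => ω e.1 w)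
      = Measure.pi fun x => bernoulliExp fun e : G.OutEdge x => a e.1 := by
    have h1 := congrArg
      (Measure.map fun (u : G.Edge → ℝ) (x : V) (e : G.OutEdge x) => u e.1) h
    rw [envLaw, Measure.map_map hcurry (by fun_prop),
      Measure.map_map hcurry (by fun_prop)] at h1
    refine h1.trans (Eq.trans ?_ Measure.map_id)
    congr 1
    funext u x ⟨e, he⟩
    subst he
    rfl
  have hlaw : ∀ x : V, HasLaw (fun w (e : G.OutEdge x) => ω e.1 w)
      (bernoulliExp fun e : G.OutEdge x => a e.1) μ := by
    intro x
    refine ⟨by fun_prop, ?_⟩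
    rw [← (measurePreserving_eval (fun x => bernoulliExp fun e : G.OutEdge x => a e.1) x).map_eq,
      ← hpi, Measure.map_map (measurable_pi_apply x) hmeas]
    rfl
  refine ⟨hω, hlaw, ?_⟩
  rw [iIndepFun_iff_map_fun_eq_pi_map fun x => (hlaw x).aemeasurable, hpi]
  simp_rw [fun x => (hlaw x).map_eq]

open Complex in
/-- The characteristic function of an environment: it involves the parameters only through their
values on the edges and the sums of these values over the edges leaving each vertex. -/
theorem integral_cexp_envLaw (ha : ∀ e, 0 < a e) [∀ x, Nonempty (G.OutEdge x)]
    (t : G.Edge → ℝ) :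
    ∫ u, cexp ((∑ e, t e * u e : ℝ) * I) ∂(G.envLaw a) =
      (∏ x, (((∑ e : G.OutEdge x, a e.1 : ℝ) - (∑ e : G.OutEdge x, t e.1 : ℝ) * I) /
        (∑ e : G.OutEdge x, a e.1 : ℝ))) * ∏ e, (a e / (a e - t e * I)) := by
  have := fun x => isProbabilityMeasure_bernoulliExp fun e : G.OutEdge x => ha e.1
  have hmeas : Measurable fun u : G.Edge → ℝ => cexp ((∑ e, t e * u e : ℝ) * I) := by fun_prop
  rw [envLaw, integral_map (Measurable.aemeasurable (by fun_prop)) hmeas.aestronglyMeasurable,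
    ← prod_prod_outEdge (fun e => (a e / (a e - t e * I) : ℂ)), ← Finset.prod_mul_distrib]
  simp_rw [← fun x => integral_cexp_bernoulliExp (fun e : G.OutEdge x => ha e.1) fun e => t e.1]
  rw [← integral_fintype_prod_eq_prod
    (f := fun x (v : G.OutEdge x → ℝ) => cexp ((∑ e, t e.1 * v e : ℝ) * I))]
  congr 1
  funext u
  rw [← exp_sum, ← Finset.sum_mul, ← ofReal_sum, ← sum_sum_outEdge]
  congr! 6 with x _ ⟨e, he⟩
  subst he
  rfl

/-- For a circulation `t`, the characteristic function at `t` is the same for the environment and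
for the environment on the dual graph: the sums over outgoing edges become sums over incoming
edges, which are equal as `a` and `t` have no divergence. -/
theorem integral_cexp_envLaw_dual (ha : ∀ e, 0 < a e) [∀ x, Nonempty (G.OutEdge x)]
    (hdiv : ∀ x, div a x = 0) {t : G.Edge → ℝ} (ht : ∀ x, div t x = 0) :
    ∫ u, Complex.exp ((∑ e : G.Edge, t e * u e.rev : ℝ) * Complex.I)
        ∂(G.dual.envLaw (dualWeight a)) =
      ∫ u, Complex.exp ((∑ e, t e * u e : ℝ) * Complex.I) ∂(G.envLaw a) := by
  have := fun x => nonempty_outEdge_dual ha (hdiv x)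
  have h := integral_cexp_envLaw (G := G.dual) (a := dualWeight a) (fun e => ha e.unrev)
    (dualWeight t)
  simp_rw [← (Edge.revEquiv G).sum_comp, ← (Edge.revEquiv G).prod_comp] at h
  refine h.trans ?_
  rw [integral_cexp_envLaw ha]
  simp_rw [dualWeight, fun x => sum_outEdge_dual_of_div_eq_zero (hdiv x),
    fun x => sum_outEdge_dual_of_div_eq_zero (ht x)]
  rfl

/-! ### The coupling -/

theorem div_add (s t : G.Edge → ℝ) (x : V) : div (fun e => s e + t e) x = div s x + div t x := by
  simp only [div, Finset.sum_add_distrib]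
  ring

theorem div_const_mul (c : ℝ) (t : G.Edge → ℝ) (x : V) :
    div (fun e => c * t e) x = c * div t x := by
  simp only [div, ← Finset.mul_sum, mul_sub]

/-- The circulations, that is, the functions on the edges that have no divergence, as a subspace of
a Euclidean space whose coordinates are indexed by the edges through the bijection `σ`. -/
def circulations {ι : Type*} (σ : G.Edge ≃ ι) : Submodule ℝ (EuclideanSpace ℝ ι) where
  carrier := {t | ∀ x, div (fun e => t (σ e)) x = 0}
  zero_mem' x := by simp [div]
  add_mem' {s t} hs ht x := by
    refine (div_add (fun e => s (σ e)) (fun e => t (σ e)) x).trans ?_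
    rw [hs x, ht x, add_zero]
  smul_mem' c t ht x := by
    refine (div_const_mul c (fun e => t (σ e)) x).trans ?_
    rw [ht x, mul_zero]

end Digraph

theorem theorem1 {V : Type*} [Fintype V] (G : Digraph V)
    (hconn : G.StronglyConnected)
    (hout : ∀ x : V, Nonempty (G.OutEdge x))
    (a : G.Edge → ℝ) (ha : ∀ e, 0 < a e) (hdiv : ∀ x, Digraph.div a x = 0) :
    ∃ (Ω : Type) (_ : MeasurableSpace Ω) (μ : Measure Ω) (_ : IsProbabilityMeasure μ)
      (ω : G.Edge → Ω → ℝ) (ω' : G.dual.Edge → Ω → ℝ) (φ : G.Edge → Ω → ℝ),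
      G.IsBernoulliExpEnvironment a μ ω ∧
      G.dual.IsBernoulliExpEnvironment (Digraph.dualWeight a) μ ω' ∧
      (∀ e, Measurable (φ e)) ∧
      (∀ᵐ w ∂μ, G.ClosedLoop fun e => φ e w) ∧
      (∀ᵐ w ∂μ, ∀ e : G.Edge, ω' e.rev w = φ e w + ω e w) ∧
      (∀ᵐ w ∂μ, ∀ π : G.Path, π.IsClosed →
        π.sum (fun e => ω e w) = π.reverse.sum (fun e => ω' e w)) := by
  have := fun x => Digraph.nonempty_outEdge_dual ha (hdiv x)
  have ha' : ∀ e, 0 < Digraph.dualWeight a e := fun e => ha e.unrev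
  have := Digraph.isProbabilityMeasure_envLaw ha
  have := Digraph.isProbabilityMeasure_envLaw ha'
  -- The edges are numbered so that the probability space does not depend on the universe of `V`.
  obtain ⟨n, ⟨σ⟩⟩ := Finite.exists_equiv_fin G.Edge
  let R : (G.Edge → ℝ) → EuclideanSpace ℝ (Fin n) := fun u => WithLp.toLp 2 fun i => u (σ.symm i)
  let R' : (G.dual.Edge → ℝ) → EuclideanSpace ℝ (Fin n) := fun u =>
    WithLp.toLp 2 fun i => u (σ.symm i).rev
  have hR : Measurable R := by fun_prop
  have hR' : Measurable R' := by fun_prop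
  have := Measure.isProbabilityMeasure_map (μ := G.envLaw a) hR.aemeasurable
  have := Measure.isProbabilityMeasure_map (μ := G.dual.envLaw (Digraph.dualWeight a))
    hR'.aemeasurable
  have hinner : ∀ s t : EuclideanSpace ℝ (Fin n),
      inner ℝ s t = ∑ e, t (σ e) * s (σ e) := fun s t => by
    rw [PiLp.inner_apply, ← σ.sum_comp]
    rfl
  have hchar : ∀ t ∈ Digraph.circulations σ, charFun ((G.envLaw a).map R) t
      = charFun ((G.dual.envLaw (Digraph.dualWeight a)).map R') t := by
    intro t ht
    rw [charFun_apply, charFun_apply, integral_map hR.aemeasurable (by fun_prop),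
      integral_map hR'.aemeasurable (by fun_prop)]
    simp_rw [hinner]
    simpa [R, R'] using (Digraph.integral_cexp_envLaw_dual ha hdiv ht).symm
  obtain ⟨ρ, hρ, h1, h2, h3⟩ := exists_coupling_sub_mem_orthogonal _ _ _ hchar
  have hloop : ∀ᵐ w ∂ρ, G.ClosedLoop fun e => w.2 (σ e) - w.1 (σ e) := by
    filter_upwards [h3] with w hw π hπ
    have hflow : WithLp.toLp 2 (fun i => π.flow (σ.symm i)) ∈ Digraph.circulations σ := fun x => by
      simpa using hπ.div_flow x
    have := hw _ hflow
    rw [real_inner_comm, hinner] at this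
    simp only [Equiv.symm_apply_apply, PiLp.sub_apply] at this
    rwa [π.sum_flow_mul fun e => w.2 (σ e) - w.1 (σ e)] at this
  refine ⟨EuclideanSpace ℝ (Fin n) × EuclideanSpace ℝ (Fin n), inferInstance, ρ, hρ,
    fun e w => w.1 (σ e), fun e w => w.2 (σ e.unrev),
    fun e w => w.2 (σ e) - w.1 (σ e), ?_, ?_, fun e => by fun_prop, hloop,
    .of_forall fun w e => (sub_add_cancel _ _).symm, ?_⟩
  · refine Digraph.isBernoulliExpEnvironment_of_map_eq ha (fun e => by fun_prop) ?_
    have hS : Measurable fun (s : EuclideanSpace ℝ (Fin n)) (e : G.Edge) => s (σ e) := by fun_prop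
    have := congrArg (Measure.map fun (s : EuclideanSpace ℝ (Fin n)) (e : G.Edge) => s (σ e)) h1
    rw [Measure.map_map hS measurable_fst, Measure.map_map hS hR] at this
    refine this.trans (Eq.trans ?_ Measure.map_id)
    congr 1
    funext u e
    simp [R]
  · refine Digraph.isBernoulliExpEnvironment_of_map_eq ha' (fun e => by fun_prop) ?_
    have hS : Measurable fun (s : EuclideanSpace ℝ (Fin n)) (e : G.dual.Edge) => s (σ e.unrev) := by
      fun_prop
    have := congrArg
      (Measure.map fun (s : EuclideanSpace ℝ (Fin n)) (e : G.dual.Edge) => s (σ e.unrev)) h2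
    rw [Measure.map_map hS measurable_snd, Measure.map_map hS hR'] at this
    refine this.trans (Eq.trans ?_ Measure.map_id)
    congr 1
    funext u e
    simp only [R', Function.comp_apply, Equiv.symm_apply_apply]
    rfl
  · filter_upwards [hloop] with w hw π hπ
    have h := hw π hπ
    rw [Digraph.Path.sum_reverse]
    simp only [Digraph.Path.sum, Finset.sum_sub_distrib] at h
    exact (sub_eq_zero.mp h).symm
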